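/- Let $\Omega_0,\Omega_1>0$ and $c\in\mathbb{C}$. Let $X_1\sim\mathcal{CN}(0,\Omega_1)$ and $\boldsymbol{x}_0\sim\mathcal{CN}(\boldsymbol{0},\Omega_0\boldsymbol{I}_2)$ be independent, where $\mathcal{CN}(0,v)$ denotes the circularly symmetric complex Gaussian law on $\mathbb{C}$ (independent real and imaginary parts, each a real Gaussian of mean $0$ and variance $v/2$) and $\mathcal{CN}(\boldsymbol{0},v\boldsymbol{I}_2)$ is the law on $\mathbb{C}^2$ of two independent $\mathcal{CN}(0,v)$ coordinates. Put $[Y_1,Y_2]^T = X_1[1,c]^T+\boldsymbol{x}_0$ and $\gamma=\Omega_1/\Omega_0$. Let $\Theta$ be the phase difference $\measuredangle(Y_1^*Y_2)-\measuredangle c$, taken modulo $2\pi$ with values in any given interval of length $2\pi$ (when $c=0$ we set $\measuredangle c=0$). Then $\Theta$ has a probability density function with respect to Lebesgue measure, which on that interval is given by \[ f_\Theta(\theta)=\frac{1}{2\pi}\,\frac{1}{1+\frac{\gamma^2|c|^2\sin^2\theta}{1+\gamma(1+|c|^2)}}\left[1+\frac{\gamma|c|\cos\theta\,\arccos\!\left(-\frac{\gamma|c|\cos\theta}{\sqrt{\gamma^2|c|^2+\gamma(1+|c|^2)+1}}\right)}{\sqrt{\gamma^2|c|^2\sin^2\theta+\gamma(1+|c|^2)+1}}\right],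 \] and which vanishes outside it. -/

import Mathlib

open MeasureTheory ProbabilityTheory
open scoped NNReal

/-- The circularly symmetric complex Gaussian law `CN(0, v)` on `ℂ`: the real and imaginary parts
are independent real Gaussians with mean `0` and variance `v / 2`. -/
noncomputable def cscg (v : ℝ≥0) : Measure ℂ :=
  ((gaussianReal 0 (v / 2)).prod (gaussianReal 0 (v / 2))).map
    (fun p : ℝ × ℝ => (⟨p.1, p.2⟩ : ℂ))

/-- The circularly symmetric complex Gaussian law `CN(0, v I_n)` on `ℂ^n`: the coordinates are
independent with law `CN(0, v)`. -/
noncomputable def cscgVec (n : ℕ) (v : ℝ≥0) : Measure (Fin n → ℂ) :=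
  Measure.pi (fun _ => cscg v)

/-- The closed-form expression for the density of the phase difference. -/
noncomputable def phaseDiffDensity (γ : ℝ) (c : ℂ) (θ : ℝ) : ℝ :=
  1 / (2 * Real.pi) *
    (1 / (1 + γ ^ 2 * ‖c‖ ^ 2 * Real.sin θ ^ 2 / (1 + γ * (1 + ‖c‖ ^ 2)))) *
    (1 + γ * ‖c‖ * Real.cos θ *
        Real.arccos (-(γ * ‖c‖ * Real.cos θ /
          √(γ ^ 2 * ‖c‖ ^ 2 + γ * (1 + ‖c‖ ^ 2) + 1))) /
      √(γ ^ 2 * ‖c‖ ^ 2 * Real.sin θ ^ 2 + γ * (1 + ‖c‖ ^ 2) + 1))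

/-! Since `conj Y₁ * Y₂` is a nonnegative multiple of `Y₂ / Y₁`, only the law of the ratio matters.
Completing the square integrates the input out and leaves a Gaussian joint density for the outputs
(`lintegral_channel`). The substitution `(y, z) ↦ (y, y * z)` has Jacobian `‖y‖ ^ 2`, and the
remaining second moment in `y` gives the ratio a density proportional to `(1 + ‖z‖ ^ 2 + γ * ‖z - c‖
^ 2)⁻²` (`lintegral_ratio`).

Rotating by the phase of `c` and passing to polar coordinates, the density of the phase at `θ` is a
constant times `∫ t / (p t² - 2 m t + r)²` over `t > 0`, with `p = 1 + γ`, `m = γ ‖c‖ cos θ`, `r = 1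
+ γ ‖c‖²`. An explicit antiderivative evaluates it (`integral_Ioi_div_sq_quadratic`).

Laws are compared by integrating nonnegative measurable test functions, so Tonelli applies without
integrability checks. -/

/-! ### Gaussian integrals and densities on the complex plane. -/

theorem lintegral_ofReal_exp_neg_mul_sq_norm {b : ℝ} (hb : 0 < b) :
    ∫⁻ z : ℂ, ENNReal.ofReal (Real.exp (-b * ‖z‖ ^ 2)) = ENNReal.ofReal (Real.pi / b) := by
  have h : ∫ z : ℂ, Real.exp (-b * ‖z‖ ^ 2) = Real.pi / b := by
    simpa using GaussianFourier.integral_rexp_neg_mul_sq_norm (V := ℂ) hb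
  have hi : Integrable (fun z : ℂ => Real.exp (-b * ‖z‖ ^ 2)) := by
    -- A non-integrable function has Bochner integral `0`, so a nonzero value forces integrability.
    refine not_imp_comm.1 integral_undef ?_
    rw [h]
    have := Real.pi_pos
    positivity
  rw [← ofReal_integral_eq_lintegral_ofReal hi (.of_forall fun _ => (Real.exp_pos _).le), h]

theorem lintegral_ofReal_sq_norm_mul_exp_neg_mul_sq_norm {b : ℝ} (hb : 0 < b) :
    ∫⁻ z : ℂ, ENNReal.ofReal (‖z‖ ^ 2 * Real.exp (-b * ‖z‖ ^ 2)) =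
      ENNReal.ofReal (Real.pi / b ^ 2) := by
  have h : ∫ z : ℂ, ‖z‖ ^ 2 * Real.exp (-b * ‖z‖ ^ 2) = Real.pi / b ^ 2 := by
    have := Complex.integral_rpow_mul_exp_neg_mul_rpow (p := 2) (q := 2) one_le_two
      (by norm_num) hb
    have e : (-(2 + 2) / 2 : ℝ) = -((2 : ℕ) : ℝ) := by norm_num
    have e' : ((2 + 2) / 2 : ℝ) = 2 := by norm_num
    rw [e, e', Real.rpow_neg hb.le, Real.rpow_natCast, Real.Gamma_two] at this
    simp only [Real.rpow_two] at this
    rw [this]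
    ring
  have hi : Integrable (fun z : ℂ => ‖z‖ ^ 2 * Real.exp (-b * ‖z‖ ^ 2)) := by
    refine not_imp_comm.1 integral_undef ?_
    rw [h]
    have := Real.pi_pos
    positivity
  rw [← ofReal_integral_eq_lintegral_ofReal hi (.of_forall fun _ => by positivity), h]

/-- Multiplication by `y` is real-linear, and its determinant is the algebra norm `‖y‖ ^ 2`. -/
theorem lintegral_comp_complex_mul_left {y : ℂ} (hy : y ≠ 0) {f : ℂ → ENNReal}
    (hf : Measurable f) :
    ∫⁻ z, f (y * z) = ENNReal.ofReal ((‖y‖ ^ 2)⁻¹) * ∫⁻ z, f z := by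
  have hdet : LinearMap.det (Algebra.lmul ℝ ℂ y) = ‖y‖ ^ 2 := by
    rw [← Algebra.norm_apply, Algebra.norm_complex_apply, Complex.normSq_eq_norm_sq]
  have hmap := Measure.map_linearMap_addHaar_eq_smul_addHaar (volume : Measure ℂ)
    (f := Algebra.lmul ℝ ℂ y) (by rw [hdet]; positivity)
  rw [hdet, abs_of_nonneg (by positivity)] at hmap
  have hm : Measurable (Algebra.lmul ℝ ℂ y : ℂ → ℂ) := by
    change Measurable (fun z => y * z)
    fun_prop
  rw [← smul_eq_mul, ← lintegral_smul_measure, ← hmap, lintegral_map hf hm]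
  rfl

theorem cscg_eq_withDensity {v : ℝ≥0} (hv : 0 < v) :
    cscg v = volume.withDensity
      (fun z : ℂ => ENNReal.ofReal ((Real.pi * v)⁻¹ * Real.exp (-(‖z‖ ^ 2 / v)))) := by
  have hv2 : v / 2 ≠ 0 := by positivity
  have hmeas := measurable_gaussianPDF 0 (v / 2)
  have key : ∀ p : ℝ × ℝ, gaussianPDF 0 (v / 2) p.1 * gaussianPDF 0 (v / 2) p.2 =
      ENNReal.ofReal ((Real.pi * v)⁻¹ *
        Real.exp (-(‖Complex.measurableEquivRealProd.symm p‖ ^ 2 / v))) := by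
    intro p
    rw [gaussianPDF, gaussianPDF, ← ENNReal.ofReal_mul (gaussianPDFReal_nonneg _ _ _)]
    congr 1
    rw [gaussianPDFReal, gaussianPDFReal, mul_mul_mul_comm, ← Real.exp_add, ← mul_inv,
      Real.mul_self_sqrt (by positivity), Complex.measurableEquivRealProd_symm_apply,
      ← Complex.normSq_eq_norm_sq, Complex.normSq_mk]
    have : (v : ℝ) ≠ 0 := by positivity
    push_cast
    congr 2
    · field_simp
    · field_simp
      ring
  have hp : MeasurePreserving Complex.measurableEquivRealProd.symm :=
    Complex.volume_preserving_equiv_real_prod.symm _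
  have hc : (fun p : ℝ × ℝ => (⟨p.1, p.2⟩ : ℂ)) = Complex.measurableEquivRealProd.symm := by
    ext p
    rw [Complex.measurableEquivRealProd_symm_apply]
  rw [cscg, gaussianReal_of_var_ne_zero _ hv2, prod_withDensity hmeas hmeas, hc]
  simp_rw [key]
  ext s hs
  rw [Measure.map_apply (MeasurableEquiv.measurable _) hs,
    withDensity_apply _ (MeasurableEquiv.measurable _ hs), withDensity_apply _ hs]
  exact hp.setLIntegral_comp_preimage (f := fun z : ℂ =>
    ENNReal.ofReal ((Real.pi * v)⁻¹ * Real.exp (-(‖z‖ ^ 2 / v)))) hs (by fun_prop)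

/-- Completes the square in `x`: the centre is the conditional mean of the input given outputs `y`,
`z`, and the remainder is the exponent of their joint density. -/
theorem gaussian_exponent_identity {v w : ℝ} (hv : 0 < v) (hw : 0 < w) (c x y z : ℂ) :
    ‖x‖ ^ 2 / w + (‖y - x‖ ^ 2 / v + ‖z - c * x‖ ^ 2 / v) =
      (1 + w / v * (1 + ‖c‖ ^ 2)) / w *
          ‖x - ((w / v / (1 + w / v * (1 + ‖c‖ ^ 2)) : ℝ) : ℂ) *
            (y + (starRingEnd ℂ) c * z)‖ ^ 2 +
        (‖y‖ ^ 2 + ‖z‖ ^ 2 + w / v * ‖z - c * y‖ ^ 2) /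
          (v * (1 + w / v * (1 + ‖c‖ ^ 2))) := by
  have hB : 0 < v + w * (1 + Complex.normSq c) := by
    have := Complex.normSq_nonneg c
    positivity
  simp only [← Complex.normSq_eq_norm_sq]
  obtain ⟨c1, c2⟩ := c
  obtain ⟨x1, x2⟩ := x
  obtain ⟨y1, y2⟩ := y
  obtain ⟨z1, z2⟩ := z
  rw [Complex.normSq_mk] at hB
  simp only [Complex.normSq_apply, Complex.sub_re, Complex.sub_im, Complex.add_re,
    Complex.add_im, Complex.mul_re, Complex.mul_im, Complex.conj_re, Complex.conj_im,
    Complex.ofReal_re, Complex.ofReal_im]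
  have hB' := hB.ne'
  field_simp
  ring

/-! ### The radial integral and the closed form. -/

theorem hasDerivAt_div_sq_quadratic {p m r t : ℝ} (hp : 0 < p) (hw : 0 < p * r - m ^ 2) :
    HasDerivAt (fun t => (m * t - r) / (2 * (p * r - m ^ 2) * (p * t ^ 2 - 2 * m * t + r)) +
        m / (2 * (p * r - m ^ 2) * √(p * r - m ^ 2)) *
          Real.arctan ((p * t - m) / √(p * r - m ^ 2)))
      (t / (p * t ^ 2 - 2 * m * t + r) ^ 2) t := by
  have hQ : 0 < p * t ^ 2 - 2 * m * t + r := by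
    have : 0 < p * (p * t ^ 2 - 2 * m * t + r) := by nlinarith [sq_nonneg (p * t - m)]
    exact pos_of_mul_pos_right this hp.le
  obtain ⟨s, hs, hsw⟩ : ∃ s, 0 < s ∧ p * r - m ^ 2 = s ^ 2 :=
    ⟨√(p * r - m ^ 2), Real.sqrt_pos.2 hw, (Real.sq_sqrt hw.le).symm⟩
  rw [hsw, Real.sqrt_sq hs.le]
  have h1 : HasDerivAt (fun t => m * t - r) m t := by
    simpa using ((hasDerivAt_id t).const_mul m).sub_const r
  have h2 : HasDerivAt (fun t => 2 * s ^ 2 * (p * t ^ 2 - 2 * m * t + r))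
      (2 * s ^ 2 * (p * (2 * t) - 2 * m)) t := by
    have := ((((hasDerivAt_pow 2 t).const_mul p).sub
      ((hasDerivAt_id t).const_mul (2 * m))).add_const r).const_mul (2 * s ^ 2)
    simpa using this
  have h3 : HasDerivAt (fun t => (p * t - m) / s) (p / s) t := by
    simpa using (((hasDerivAt_id t).const_mul p).sub_const m).div_const s
  have h := (h1.div h2 (by positivity)).add (h3.arctan.const_mul (m / (2 * s ^ 2 * s)))
  refine h.congr_deriv ?_
  -- With `Q` the quadratic, this is `p * Q = (p * t - m) ^ 2 + s ^ 2`.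
  have e : 1 + ((p * t - m) / s) ^ 2 = p * (p * t ^ 2 - 2 * m * t + r) / s ^ 2 := by
    field_simp
    linear_combination -hsw
  rw [e]
  -- Eliminating `r` removes the relation between `p`, `m`, `r`, `s`, so `ring` can close the goal.
  have hr : r = (s ^ 2 + m ^ 2) / p := by
    field_simp
    linear_combination hsw
  have hQ' := hQ.ne'
  generalize hq : p * t ^ 2 - 2 * m * t + r = Q at *
  field_simp
  rw [← hq, hr]
  field_simp
  ring

theorem tendsto_atTop_div_sq_quadratic_antideriv {p m r : ℝ} (hp : 0 < p)
    (hw : 0 < p * r - m ^ 2) :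
    Filter.Tendsto (fun t => (m * t - r) / (2 * (p * r - m ^ 2) * (p * t ^ 2 - 2 * m * t + r)) +
        m / (2 * (p * r - m ^ 2) * √(p * r - m ^ 2)) *
          Real.arctan ((p * t - m) / √(p * r - m ^ 2))) Filter.atTop
      (nhds (m / (2 * (p * r - m ^ 2) * √(p * r - m ^ 2)) * (Real.pi / 2))) := by
  generalize hW : p * r - m ^ 2 = w at *
  have h1 : Filter.Tendsto (fun t => (m * t - r) / (2 * w * (p * t ^ 2 - 2 * m * t + r)))
      Filter.atTop (nhds 0) := by
    have h := (tendsto_inv_atTop_zero (𝕜 := ℝ))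
    have hn : Filter.Tendsto (fun t : ℝ => m * t⁻¹ - r * t⁻¹ ^ 2) Filter.atTop (nhds 0) := by
      simpa using (h.const_mul m).sub ((h.pow 2).const_mul r)
    have hd : Filter.Tendsto (fun t : ℝ => 2 * w * (p - 2 * m * t⁻¹ + r * t⁻¹ ^ 2))
        Filter.atTop (nhds (2 * w * p)) := by
      simpa using (((h.const_mul (2 * m)).const_sub p).add ((h.pow 2).const_mul r)).const_mul
        (2 * w)
    have hnd := hn.div hd (by positivity)
    rw [zero_div] at hnd
    refine hnd.congr' ?_
    filter_upwards [Filter.eventually_gt_atTop 0] with t ht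
    simp only [Pi.div_apply]
    rw [← mul_div_mul_right _ _ (pow_ne_zero 2 ht.ne')]
    congr 1 <;> field_simp
  have h2 : Filter.Tendsto (fun t => Real.arctan ((p * t - m) / √w)) Filter.atTop
      (nhds (Real.pi / 2)) := by
    refine (Real.tendsto_arctan_atTop.mono_right nhdsWithin_le_nhds).comp ?_
    refine Filter.Tendsto.atTop_div_const (Real.sqrt_pos.2 hw) ?_
    exact Filter.tendsto_atTop_add_const_right _ _
      (Filter.tendsto_id.const_mul_atTop hp)
  simpa using h1.add (h2.const_mul (m / (2 * w * √w)))

/-- Converts the boundary terms of the antiderivative to the arccosine; for `w = p * r - m ^ 2` the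
root on the right is `√(p * r)`. -/
theorem pi_div_two_add_arctan_eq_arccos {m w : ℝ} (hw : 0 < w) :
    Real.pi / 2 + Real.arctan (m / √w) = Real.arccos (-(m / √(w + m ^ 2))) := by
  rw [Real.arccos_neg, Real.arccos, Real.arctan_eq_arcsin]
  have : m / √w / √(1 + (m / √w) ^ 2) = m / √(w + m ^ 2) := by
    rw [div_pow, Real.sq_sqrt hw.le, div_div, ← Real.sqrt_mul hw.le]
    congr 2
    field_simp
  rw [this]
  ring

theorem div_sq_quadratic_nonneg (p m r : ℝ) :
    ∀ t ∈ Set.Ioi (0 : ℝ), 0 ≤ t / (p * t ^ 2 - 2 * m * t + r) ^ 2 :=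
  fun _ ht => div_nonneg (le_of_lt ht) (sq_nonneg _)

theorem integrableOn_Ioi_div_sq_quadratic {p m r : ℝ} (hp : 0 < p) (hw : 0 < p * r - m ^ 2) :
    IntegrableOn (fun t => t / (p * t ^ 2 - 2 * m * t + r) ^ 2) (Set.Ioi 0) :=
  integrableOn_Ioi_deriv_of_nonneg' (fun _ _ => hasDerivAt_div_sq_quadratic hp hw)
    (div_sq_quadratic_nonneg p m r) (tendsto_atTop_div_sq_quadratic_antideriv hp hw)

/-- The radial integral of the squared inverse of a positive definite quadratic. -/
theorem integral_Ioi_div_sq_quadratic {p m r : ℝ} (hp : 0 < p) (hw : 0 < p * r - m ^ 2) :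
    ∫ t in Set.Ioi 0, t / (p * t ^ 2 - 2 * m * t + r) ^ 2 =
      1 / (2 * (p * r - m ^ 2)) * (1 + m * Real.arccos (-(m / √(p * r))) /
        √(p * r - m ^ 2)) := by
  have hr : r ≠ 0 := by
    rintro rfl
    nlinarith [sq_nonneg m]
  rw [integral_Ioi_of_hasDerivAt_of_nonneg' (fun _ _ => hasDerivAt_div_sq_quadratic hp hw)
    (div_sq_quadratic_nonneg p m r) (tendsto_atTop_div_sq_quadratic_antideriv hp hw)]
  have h := pi_div_two_add_arctan_eq_arccos (m := m) hw
  rw [sub_add_cancel] at h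
  rw [← h]
  simp only [ne_eq, OfNat.ofNat_ne_zero, not_false_eq_true, zero_pow, mul_zero, sub_zero,
    zero_add, zero_sub, neg_div, Real.arctan_neg]
  have hs : √(p * r - m ^ 2) ≠ 0 := (Real.sqrt_pos.2 hw).ne'
  generalize √(p * r - m ^ 2) = s at *
  generalize p * r - m ^ 2 = w at *
  have := hw.ne'
  generalize Real.arctan (m / s) = A
  field_simp
  ring

theorem phaseDiff_discriminant_eq (γ : ℝ) (c : ℂ) (θ : ℝ) :
    (1 + γ) * (1 + γ * ‖c‖ ^ 2) - (γ * ‖c‖ * Real.cos θ) ^ 2 =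
      γ ^ 2 * ‖c‖ ^ 2 * Real.sin θ ^ 2 + γ * (1 + ‖c‖ ^ 2) + 1 := by
  linear_combination (-(γ ^ 2 * ‖c‖ ^ 2)) * Real.sin_sq_add_cos_sq θ

theorem phaseDiff_discriminant_pos {γ : ℝ} (hγ : 0 < γ) (c : ℂ) (θ : ℝ) :
    0 < (1 + γ) * (1 + γ * ‖c‖ ^ 2) - (γ * ‖c‖ * Real.cos θ) ^ 2 := by
  rw [phaseDiff_discriminant_eq]
  positivity

theorem phaseDiffDensity_eq_integral {γ : ℝ} (hγ : 0 < γ) (c : ℂ) (θ : ℝ) :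
    phaseDiffDensity γ c θ = (1 + γ * (1 + ‖c‖ ^ 2)) / Real.pi * ∫ t in Set.Ioi 0,
      t / ((1 + γ) * t ^ 2 - 2 * (γ * ‖c‖ * Real.cos θ) * t + (1 + γ * ‖c‖ ^ 2)) ^ 2 := by
  have hw := phaseDiff_discriminant_pos hγ c θ
  rw [integral_Ioi_div_sq_quadratic (by positivity) hw, phaseDiffDensity]
  rw [phaseDiff_discriminant_eq] at hw ⊢
  rw [show (1 + γ) * (1 + γ * ‖c‖ ^ 2) = γ ^ 2 * ‖c‖ ^ 2 + γ * (1 + ‖c‖ ^ 2) + 1 by ring,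
    ← mul_assoc]
  congr 1
  have : 1 + γ ^ 2 * ‖c‖ ^ 2 * Real.sin θ ^ 2 / (1 + γ * (1 + ‖c‖ ^ 2)) =
    (γ ^ 2 * ‖c‖ ^ 2 * Real.sin θ ^ 2 + γ * (1 + ‖c‖ ^ 2) + 1) /
      (1 + γ * (1 + ‖c‖ ^ 2)) := by
    field_simp
    ring
  rw [this]
  field_simp

theorem phaseDiffDensity_nonneg {γ : ℝ} (hγ : 0 < γ) (c : ℂ) (θ : ℝ) :
    0 ≤ phaseDiffDensity γ c θ := by
  rw [phaseDiffDensity_eq_integral hγ]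
  have := Real.pi_pos
  have := setIntegral_nonneg (μ := volume) measurableSet_Ioi (div_sq_quadratic_nonneg (1 + γ)
    (γ * ‖c‖ * Real.cos θ) (1 + γ * ‖c‖ ^ 2))
  positivity

theorem ofReal_phaseDiffDensity_eq_lintegral {γ : ℝ} (hγ : 0 < γ) (c : ℂ) (θ : ℝ) :
    ENNReal.ofReal (phaseDiffDensity γ c θ) = ∫⁻ t in Set.Ioi 0,
      ENNReal.ofReal ((1 + γ * (1 + ‖c‖ ^ 2)) / Real.pi) * ENNReal.ofReal (t / ((1 + γ) * t ^ 2 -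
        2 * (γ * ‖c‖ * Real.cos θ) * t + (1 + γ * ‖c‖ ^ 2)) ^ 2) := by
  have hB : 0 ≤ (1 + γ * (1 + ‖c‖ ^ 2)) / Real.pi := by
    have := Real.pi_pos
    positivity
  rw [phaseDiffDensity_eq_integral hγ, ENNReal.ofReal_mul hB,
    ofReal_integral_eq_lintegral_ofReal (integrableOn_Ioi_div_sq_quadratic (by positivity)
      (phaseDiff_discriminant_pos hγ c θ)) ((ae_restrict_iff' measurableSet_Ioi).2
      (.of_forall (div_sq_quadratic_nonneg _ _ _))),
    lintegral_const_mul _ (by fun_prop)]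

theorem measurable_phaseDiffDensity (γ : ℝ) (c : ℂ) : Measurable (phaseDiffDensity γ c) := by
  have := Real.continuous_arccos.measurable
  unfold phaseDiffDensity
  fun_prop

/-! ### Joint density of the outputs. -/

/-- The density of the output of the channel `X ↦ X • (1, c) + noise` with circularly symmetric
Gaussian input of variance `w` and noise of variance `v`. -/
noncomputable def channelDensity (v w : ℝ) (c : ℂ) (p : ℂ × ℂ) : ℝ :=
  (Real.pi ^ 2 * v ^ 2 * (1 + w / v * (1 + ‖c‖ ^ 2)))⁻¹ *
    Real.exp (-((‖p.1‖ ^ 2 + ‖p.2‖ ^ 2 + w / v * ‖p.2 - c * p.1‖ ^ 2) /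
      (v * (1 + w / v * (1 + ‖c‖ ^ 2)))))

theorem measurable_channelDensity (v w : ℝ) (c : ℂ) : Measurable (channelDensity v w c) := by
  unfold channelDensity
  fun_prop

theorem lintegral_gaussian_product_eq_channelDensity {v w : ℝ} (hv : 0 < v) (hw : 0 < w)
    (c : ℂ) (p : ℂ × ℂ) :
    ∫⁻ x : ℂ, ENNReal.ofReal ((Real.pi * w)⁻¹ * Real.exp (-(‖x‖ ^ 2 / w))) *
      (ENNReal.ofReal ((Real.pi * v)⁻¹ * Real.exp (-(‖p.1 - x‖ ^ 2 / v))) *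
        ENNReal.ofReal ((Real.pi * v)⁻¹ * Real.exp (-(‖p.2 - c * x‖ ^ 2 / v)))) =
      ENNReal.ofReal (channelDensity v w c p) := by
  have hπ := Real.pi_pos
  have hB : 0 < 1 + w / v * (1 + ‖c‖ ^ 2) := by positivity
  set B := 1 + w / v * (1 + ‖c‖ ^ 2) with hBdef
  set x₀ : ℂ := ((w / v / B : ℝ) : ℂ) * (p.1 + (starRingEnd ℂ) c * p.2)
  set E := (‖p.1‖ ^ 2 + ‖p.2‖ ^ 2 + w / v * ‖p.2 - c * p.1‖ ^ 2) / (v * B) with hE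
  have hx : ∀ x : ℂ, ENNReal.ofReal ((Real.pi * w)⁻¹ * Real.exp (-(‖x‖ ^ 2 / w))) *
      (ENNReal.ofReal ((Real.pi * v)⁻¹ * Real.exp (-(‖p.1 - x‖ ^ 2 / v))) *
        ENNReal.ofReal ((Real.pi * v)⁻¹ * Real.exp (-(‖p.2 - c * x‖ ^ 2 / v)))) =
      ENNReal.ofReal ((Real.pi * w)⁻¹ * ((Real.pi * v)⁻¹ * (Real.pi * v)⁻¹) * Real.exp (-E)) *
        ENNReal.ofReal (Real.exp (-(B / w) * ‖x + -x₀‖ ^ 2)) := by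
    intro x
    rw [← ENNReal.ofReal_mul (by positivity), ← ENNReal.ofReal_mul (by positivity),
      ← ENNReal.ofReal_mul (by positivity)]
    congr 1
    rw [mul_mul_mul_comm (Real.pi * v)⁻¹, mul_mul_mul_comm, ← Real.exp_add, ← Real.exp_add,
      mul_assoc _ (Real.exp (-E)), ← Real.exp_add]
    congr 2
    rw [← sub_eq_add_neg]
    linear_combination -gaussian_exponent_identity hv hw c x p.1 p.2
  simp_rw [hx]
  rw [lintegral_const_mul _ (by fun_prop),
    lintegral_add_right_eq_self (fun x : ℂ => ENNReal.ofReal (Real.exp (-(B / w) * ‖x‖ ^ 2))),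
    lintegral_ofReal_exp_neg_mul_sq_norm (by positivity), ← ENNReal.ofReal_mul (by positivity)]
  congr 1
  rw [channelDensity, ← hBdef, ← hE]
  field_simp

/-- For fixed input `x`, translating by `(x, c * x)` turns noise into output; Tonelli then
integrates `x` out. -/
theorem lintegral_channel {v w : ℝ≥0} (hv : 0 < v) (hw : 0 < w) (c : ℂ)
    {h : ℂ × ℂ → ENNReal} (hh : Measurable h) :
    ∫⁻ x, ∫⁻ p, h (x + p.1, c * x + p.2) ∂((cscg v).prod (cscg v)) ∂(cscg w) =
      ∫⁻ p, ENNReal.ofReal (channelDensity v w c p) * h p := by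
  set D : ℂ → ENNReal := fun z =>
    ENNReal.ofReal ((Real.pi * v)⁻¹ * Real.exp (-(‖z‖ ^ 2 / v))) with hD
  set d : ℂ → ENNReal := fun z =>
    ENNReal.ofReal ((Real.pi * w)⁻¹ * Real.exp (-(‖z‖ ^ 2 / w))) with hd
  have hDm : Measurable D := by fun_prop
  have hdm : Measurable d := by fun_prop
  have : (volume : Measure (ℂ × ℂ)).IsAddRightInvariant := by
    rw [Measure.volume_eq_prod]
    infer_instance
  have hinner : ∀ x : ℂ, ∫⁻ p, h (x + p.1, c * x + p.2) ∂((cscg v).prod (cscg v)) =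
      ∫⁻ p : ℂ × ℂ, D (p.1 - x) * D (p.2 - c * x) * h p := by
    intro x
    rw [cscg_eq_withDensity hv, prod_withDensity hDm hDm,
      lintegral_withDensity_eq_lintegral_mul _ (by fun_prop) (by fun_prop),
      ← lintegral_add_right_eq_self (μ := (volume : Measure (ℂ × ℂ)))
        (fun p : ℂ × ℂ => D (p.1 - x) * D (p.2 - c * x) * h p) (x, c * x)]
    refine lintegral_congr fun p => ?_
    have e : (x + p.1, c * x + p.2) = p + (x, c * x) :=
      Prod.ext (add_comm _ _) (add_comm _ _)
    simp only [Pi.mul_apply, e, Prod.fst_add, Prod.snd_add, add_sub_cancel_right]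
  simp_rw [hinner]
  rw [cscg_eq_withDensity hw, lintegral_withDensity_eq_lintegral_mul _ hdm ?_]
  · simp only [Pi.mul_apply]
    have : ∀ x : ℂ, d x * ∫⁻ p : ℂ × ℂ, D (p.1 - x) * D (p.2 - c * x) * h p =
        ∫⁻ p : ℂ × ℂ, d x * (D (p.1 - x) * D (p.2 - c * x)) * h p := by
      intro x
      rw [← lintegral_const_mul _ (by fun_prop)]
      simp_rw [mul_assoc]
    simp_rw [this]
    rw [lintegral_lintegral_swap (by fun_prop)]
    refine lintegral_congr fun p => ?_
    rw [lintegral_mul_const _ (by fun_prop)]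
    congr 1
    exact lintegral_gaussian_product_eq_channelDensity (NNReal.coe_pos.2 hv)
      (NNReal.coe_pos.2 hw) c p
  · refine Measurable.lintegral_prod_right' (f := fun q : ℂ × ℂ × ℂ =>
      D (q.2.1 - q.1) * D (q.2.2 - c * q.1) * h q.2) ?_
    fun_prop

/-! ### Density of the ratio. -/

/-- The density of the ratio of the two outputs of the channel. -/
noncomputable def ratioDensity (γ : ℝ) (c z : ℂ) : ℝ :=
  (1 + γ * (1 + ‖c‖ ^ 2)) / Real.pi / (1 + ‖z‖ ^ 2 + γ * ‖z - c‖ ^ 2) ^ 2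

theorem measurable_ratioDensity (γ : ℝ) (c : ℂ) : Measurable (ratioDensity γ c) := by
  unfold ratioDensity
  fun_prop

theorem lintegral_sq_norm_mul_channelDensity {v w : ℝ} (hv : 0 < v) (hw : 0 < w) (c z : ℂ) :
    ∫⁻ y : ℂ, ENNReal.ofReal (‖y‖ ^ 2) * ENNReal.ofReal (channelDensity v w c (y, y * z)) =
      ENNReal.ofReal (ratioDensity (w / v) c z) := by
  have hπ := Real.pi_pos
  have hB : 0 < 1 + w / v * (1 + ‖c‖ ^ 2) := by positivity
  have hR : 0 < 1 + ‖z‖ ^ 2 + w / v * ‖z - c‖ ^ 2 := by positivity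
  simp only [channelDensity, ratioDensity]
  generalize 1 + w / v * (1 + ‖c‖ ^ 2) = B at *
  have hy : ∀ y : ℂ, ENNReal.ofReal (‖y‖ ^ 2) *
      ENNReal.ofReal ((Real.pi ^ 2 * v ^ 2 * B)⁻¹ * Real.exp (-((‖y‖ ^ 2 + ‖y * z‖ ^ 2 +
        w / v * ‖y * z - c * y‖ ^ 2) / (v * B)))) =
      ENNReal.ofReal ((Real.pi ^ 2 * v ^ 2 * B)⁻¹) * ENNReal.ofReal (‖y‖ ^ 2 *
        Real.exp (-((1 + ‖z‖ ^ 2 + w / v * ‖z - c‖ ^ 2) / (v * B)) * ‖y‖ ^ 2)) := by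
    intro y
    rw [← ENNReal.ofReal_mul (by positivity), ← ENNReal.ofReal_mul (by positivity),
      mul_left_comm, mul_comm c y, ← mul_sub, norm_mul, norm_mul]
    congr 4
    ring
  simp_rw [hy]
  rw [lintegral_const_mul _ (by fun_prop),
    lintegral_ofReal_sq_norm_mul_exp_neg_mul_sq_norm (by positivity),
    ← ENNReal.ofReal_mul (by positivity)]
  congr 1
  field_simp

theorem lintegral_ratio {v w : ℝ} (hv : 0 < v) (hw : 0 < w) (c : ℂ) {h : ℂ → ENNReal}
    (hh : Measurable h) :
    ∫⁻ p : ℂ × ℂ, ENNReal.ofReal (channelDensity v w c p) * h (p.2 / p.1) =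
      ∫⁻ z, ENNReal.ofReal (ratioDensity (w / v) c z) * h z := by
  have hm := measurable_channelDensity v w c
  rw [Measure.volume_eq_prod, lintegral_prod _ (by fun_prop)]
  have hne : ∀ᵐ y : ℂ, y ≠ 0 := Measure.ae_ne volume 0
  have h1 : ∀ᵐ y : ℂ, ∫⁻ z, ENNReal.ofReal (channelDensity v w c (y, z)) * h (z / y) =
      ∫⁻ z, ENNReal.ofReal (‖y‖ ^ 2) * ENNReal.ofReal (channelDensity v w c (y, y * z)) *
        h z := by
    filter_upwards [hne] with y hy
    have := lintegral_comp_complex_mul_left hy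
      (f := fun z => ENNReal.ofReal (channelDensity v w c (y, z)) * h (z / y)) (by fun_prop)
    simp_rw [mul_assoc]
    rw [lintegral_const_mul _ (by fun_prop)]
    simp only [mul_div_cancel_left₀ _ hy] at this
    rw [this, ← mul_assoc, ← ENNReal.ofReal_mul (by positivity),
      mul_inv_cancel₀ (by positivity), ENNReal.ofReal_one, one_mul]
  rw [lintegral_congr_ae h1, lintegral_lintegral_swap (by fun_prop)]
  refine lintegral_congr fun z => ?_
  rw [lintegral_mul_const _ (by fun_prop), lintegral_sq_norm_mul_channelDensity hv hw]

/-! ### Angles modulo `2π` and polar coordinates. -/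

theorem measurable_toIocMod {p : ℝ} (hp : 0 < p) (a : ℝ) : Measurable (toIocMod hp a) := by
  have : toIocMod hp a = fun b => a + p - Int.fract ((a + p - b) / p) * p :=
    funext (toIocMod_eq_sub_fract_mul hp a)
  rw [this]
  exact measurable_const.sub
    ((measurable_fract.comp ((measurable_const.sub measurable_id).div_const p)).mul_const p)

theorem toIocMod_two_pi_eq_of_angle_eq (a : ℝ) {x y : ℝ}
    (h : (x : Real.Angle) = (y : Real.Angle)) :
    toIocMod Real.two_pi_pos a x = toIocMod Real.two_pi_pos a y := by
  obtain ⟨k, hk⟩ := Real.Angle.angle_eq_iff_two_pi_dvd_sub.1 h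
  rw [show x = y + k • (2 * Real.pi) by rw [zsmul_eq_mul]; linarith, toIocMod_add_zsmul]

/-- Up to a null set, both intervals are fundamental domains for translation by `2π`. -/
theorem setLIntegral_Ioo_eq_of_periodic (a : ℝ) {f : ℝ → ENNReal}
    (hf : Function.Periodic f (2 * Real.pi)) :
    ∫⁻ x in Set.Ioo (-Real.pi) Real.pi, f x = ∫⁻ x in Set.Ioc a (a + 2 * Real.pi), f x := by
  have h := (isAddFundamentalDomain_Ioc Real.two_pi_pos (-Real.pi)).setLIntegral_eq
    (isAddFundamentalDomain_Ioc Real.two_pi_pos a) f (by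
      rintro ⟨_, k, rfl⟩ x
      change f (k • (2 * Real.pi) + x) = f x
      rw [add_comm]
      exact hf.zsmul k x)
  rw [setLIntegral_congr Ioo_ae_eq_Ioc, ← h]
  congr 3
  ring

/-- Factoring out the unit `u` moves `c` to the positive real axis or to `0`, so the angle enters
only through `cos φ`. -/
theorem ratioDensity_rotate {γ : ℝ} {c u : ℂ} (hu : ‖u‖ = 1) (hc : c = ‖c‖ * u) (r φ : ℝ) :
    ratioDensity γ c (u * (r * (Real.cos φ + Real.sin φ * Complex.I))) =
      (1 + γ * (1 + ‖c‖ ^ 2)) / Real.pi / ((1 + γ) * r ^ 2 -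
        2 * (γ * ‖c‖ * Real.cos φ) * r + (1 + γ * ‖c‖ ^ 2)) ^ 2 := by
  have h1 : ‖u * (r * (Real.cos φ + Real.sin φ * Complex.I))‖ ^ 2 = r ^ 2 := by
    rw [norm_mul, hu, one_mul, ← Complex.normSq_eq_norm_sq, Complex.normSq_apply]
    simp only [Complex.mul_re, Complex.mul_im, Complex.add_re, Complex.add_im,
      Complex.ofReal_re, Complex.ofReal_im, Complex.I_re, Complex.I_im]
    linear_combination r ^ 2 * Real.sin_sq_add_cos_sq φ
  have h2 : ‖u * (r * (Real.cos φ + Real.sin φ * Complex.I)) - c‖ ^ 2 =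
      r ^ 2 - 2 * ‖c‖ * r * Real.cos φ + ‖c‖ ^ 2 := by
    have : u * (r * (Real.cos φ + Real.sin φ * Complex.I)) - c =
        u * (r * (Real.cos φ + Real.sin φ * Complex.I) - ‖c‖) := by
      linear_combination -hc
    rw [this, norm_mul, hu, one_mul, ← Complex.normSq_eq_norm_sq, Complex.normSq_apply]
    simp only [Complex.mul_re, Complex.mul_im, Complex.add_re, Complex.add_im, Complex.sub_re,
      Complex.sub_im, Complex.ofReal_re, Complex.ofReal_im, Complex.I_re, Complex.I_im]
    linear_combination r ^ 2 * Real.sin_sq_add_cos_sq φ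
  rw [ratioDensity, h1, h2]
  congr 2
  ring

theorem lintegral_ratioDensity_mul_comp_arg {γ : ℝ} (hγ : 0 < γ) (c : ℂ) (a : ℝ)
    {g : ℝ → ENNReal} (hg : Measurable g) :
    ∫⁻ z, ENNReal.ofReal (ratioDensity γ c z) *
        g (toIocMod Real.two_pi_pos a (Complex.arg z - Complex.arg c)) =
      ∫⁻ θ in Set.Ioc a (a + 2 * Real.pi), ENNReal.ofReal (phaseDiffDensity γ c θ) * g θ := by
  have hmod := measurable_toIocMod Real.two_pi_pos a
  have hρ := measurable_ratioDensity γ c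
  set u : ℂ := Complex.exp (Complex.arg c * Complex.I) with hu_def
  have hu : ‖u‖ = 1 := Complex.norm_exp_ofReal_mul_I _
  have hu0 : u ≠ 0 := Complex.exp_ne_zero _
  -- This covers `c = 0` too: then `arg c = 0` and `u = 1`.
  have hc : c = ‖c‖ * u := (Complex.norm_mul_exp_arg_mul_I c).symm
  have hrot := lintegral_comp_complex_mul_left hu0 (f := fun z =>
    ENNReal.ofReal (ratioDensity γ c z) *
      g (toIocMod Real.two_pi_pos a (Complex.arg z - Complex.arg c)))
    (by have := Complex.measurable_arg; fun_prop)
  rw [hu, one_pow, inv_one, ENNReal.ofReal_one, one_mul] at hrot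
  have hpt : ∀ p ∈ polarCoord.target, ENNReal.ofReal p.1 •
      (ENNReal.ofReal (ratioDensity γ c (u * Complex.polarCoord.symm p)) *
        g (toIocMod Real.two_pi_pos a
          (Complex.arg (u * Complex.polarCoord.symm p) - Complex.arg c))) =
      ENNReal.ofReal ((1 + γ * (1 + ‖c‖ ^ 2)) / Real.pi) * ENNReal.ofReal (p.1 /
        ((1 + γ) * p.1 ^ 2 - 2 * (γ * ‖c‖ * Real.cos p.2) * p.1 + (1 + γ * ‖c‖ ^ 2)) ^ 2) *
        g (toIocMod Real.two_pi_pos a p.2) := by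
    rintro ⟨r, φ⟩ hp
    have hr : 0 < r := hp.1
    have hφ : φ ∈ Set.Ioo (-Real.pi) Real.pi := hp.2
    have hsymm : Complex.polarCoord.symm (r, φ) =
        r * (Real.cos φ + Real.sin φ * Complex.I) := Complex.polarCoord_symm_apply _
    have harg : Complex.arg (r * (Real.cos φ + Real.sin φ * Complex.I)) = φ := by
      push_cast
      exact Complex.arg_mul_cos_add_sin_mul_I hr ⟨hφ.1, hφ.2.le⟩
    have hne : (r * (Real.cos φ + Real.sin φ * Complex.I) : ℂ) ≠ 0 := by
      push_cast
      rw [← Complex.exp_mul_I]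
      exact mul_ne_zero (Complex.ofReal_ne_zero.2 hr.ne') (Complex.exp_ne_zero _)
    have hargu : Complex.arg u = Complex.arg c :=
      (Complex.arg_exp_mul_I _).trans
        ((toIocMod_eq_self _).2 (by
          have := Complex.arg_mem_Ioc c
          rwa [show -Real.pi + 2 * Real.pi = Real.pi by ring]))
    have hang : toIocMod Real.two_pi_pos a
        (Complex.arg (u * (r * (Real.cos φ + Real.sin φ * Complex.I))) - Complex.arg c) =
        toIocMod Real.two_pi_pos a φ := by
      apply toIocMod_two_pi_eq_of_angle_eq
      rw [Real.Angle.coe_sub, Complex.arg_mul_coe_angle hu0 hne, harg, hargu,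
        add_sub_cancel_left]
    simp only
    rw [hsymm, hang, ratioDensity_rotate hu hc, smul_eq_mul, ← mul_assoc,
      ← ENNReal.ofReal_mul hr.le, ← ENNReal.ofReal_mul (by have := Real.pi_pos; positivity)]
    congr 2
    ring
  rw [← hrot, ← Complex.lintegral_comp_polarCoord_symm,
    setLIntegral_congr_fun polarCoord.open_target.measurableSet hpt, polarCoord_target,
    Measure.volume_eq_prod, ← Measure.prod_restrict,
    lintegral_prod_symm' _ (by fun_prop)]
  have hφ : ∀ φ : ℝ, ∫⁻ r in Set.Ioi 0, ENNReal.ofReal ((1 + γ * (1 + ‖c‖ ^ 2)) / Real.pi) *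
      ENNReal.ofReal (r / ((1 + γ) * r ^ 2 - 2 * (γ * ‖c‖ * Real.cos φ) * r +
        (1 + γ * ‖c‖ ^ 2)) ^ 2) * g (toIocMod Real.two_pi_pos a φ) =
      ENNReal.ofReal (phaseDiffDensity γ c φ) * g (toIocMod Real.two_pi_pos a φ) := by
    intro φ
    rw [lintegral_mul_const _ (by fun_prop), ← ofReal_phaseDiffDensity_eq_lintegral hγ]
  simp only [hφ]
  rw [setLIntegral_Ioo_eq_of_periodic a]
  · refine setLIntegral_congr_fun measurableSet_Ioc fun θ hθ => ?_
    rw [(toIocMod_eq_self _).2 hθ]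
  · intro φ
    simp only [phaseDiffDensity, Real.cos_add_two_pi, Real.sin_add_two_pi, toIocMod_add_right]

/-! ### Law of the phase difference. -/

theorem arg_conj_mul (x y : ℂ) : Complex.arg ((starRingEnd ℂ) x * y) = Complex.arg (y / x) := by
  rcases eq_or_ne x 0 with rfl | hx
  · simp
  · have h : (starRingEnd ℂ) x * y = ((‖x‖ ^ 2 : ℝ) : ℂ) * (y / x) := by
      rw [← Complex.normSq_eq_norm_sq, Complex.normSq_eq_conj_mul_self]
      field_simp
    rw [h, Complex.arg_real_mul _ (by positivity)]

theorem hasLaw_phaseDiff {S : Type*} [MeasurableSpace S] {P : Measure S} [IsProbabilityMeasure P]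
    {v w : ℝ≥0} (hv : 0 < v) (hw : 0 < w) (c : ℂ) {X : S → ℂ} {N : S → Fin 2 → ℂ}
    (hX : HasLaw X (cscg w) P) (hN : HasLaw N (cscgVec 2 v) P) (hXN : IndepFun X N P) (a : ℝ) :
    HasLaw (fun ω => toIocMod Real.two_pi_pos a (Complex.arg ((starRingEnd ℂ) (X ω + N ω 0) *
        (c * X ω + N ω 1)) - Complex.arg c))
      (volume.withDensity ((Set.Ioc a (a + 2 * Real.pi)).indicator
        fun θ => ENNReal.ofReal (phaseDiffDensity (w / v) c θ))) P := by
  have hmod := measurable_toIocMod Real.two_pi_pos a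
  have harg := Complex.measurable_arg
  have hXm := hX.aemeasurable
  have hNm := hN.aemeasurable
  have : IsProbabilityMeasure (cscg v) := by
    rw [cscg]
    refine Measure.isProbabilityMeasure_map (Measurable.aemeasurable ?_)
    exact Complex.measurableEquivRealProd.symm.measurable
  have hγ : (0 : ℝ) < w / v := div_pos (NNReal.coe_pos.2 hw) (NNReal.coe_pos.2 hv)
  have hTm : AEMeasurable (fun ω => toIocMod Real.two_pi_pos a
      (Complex.arg ((starRingEnd ℂ) (X ω + N ω 0) * (c * X ω + N ω 1)) - Complex.arg c)) P := by
    have h0 : AEMeasurable (fun ω => N ω 0) P := (measurable_pi_apply 0).comp_aemeasurable hNm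
    have h1 : AEMeasurable (fun ω => N ω 1) P := (measurable_pi_apply 1).comp_aemeasurable hNm
    have hconj : Measurable (starRingEnd ℂ) := Complex.continuous_conj.measurable
    exact hmod.comp_aemeasurable ((harg.comp_aemeasurable
      ((hconj.comp_aemeasurable (hXm.add h0)).mul ((hXm.const_mul c).add h1))).sub_const _)
  refine ⟨hTm, Measure.ext_of_lintegral _ fun g hg => ?_⟩
  have hpair : HasLaw (fun ω => (X ω, N ω)) ((cscg w).prod (cscgVec 2 v)) P :=
    hXN.hasLaw_prod hX hN
  have : IsProbabilityMeasure (cscgVec 2 v) := by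
    rw [cscgVec]
    infer_instance
  set G : ℂ → ENNReal := fun z => g (toIocMod Real.two_pi_pos a (Complex.arg z - Complex.arg c))
    with hG
  have hGm : Measurable G := by fun_prop
  have hvec : ∀ x : ℂ, ∫⁻ n, G ((c * x + n 1) / (x + n 0)) ∂(cscgVec 2 v) =
      ∫⁻ p, G ((c * x + p.2) / (x + p.1)) ∂((cscg v).prod (cscg v)) := fun x =>
    (measurePreserving_finTwoArrow (cscg v)).lintegral_comp
      (f := fun p : ℂ × ℂ => G ((c * x + p.2) / (x + p.1))) (by fun_prop)
  calc ∫⁻ t, g t ∂(Measure.map _ P)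
      = ∫⁻ ω, G ((c * X ω + N ω 1) / (X ω + N ω 0)) ∂P := by
        rw [lintegral_map' hg.aemeasurable hTm]
        simp only [arg_conj_mul, hG]
    _ = ∫⁻ q, G ((c * q.1 + q.2 1) / (q.1 + q.2 0)) ∂((cscg w).prod (cscgVec 2 v)) :=
        hpair.lintegral_comp (f := fun q : ℂ × (Fin 2 → ℂ) =>
          G ((c * q.1 + q.2 1) / (q.1 + q.2 0))) (by fun_prop)
    _ = ∫⁻ x, ∫⁻ p, G ((c * x + p.2) / (x + p.1)) ∂((cscg v).prod (cscg v)) ∂(cscg w) := by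
        rw [lintegral_prod _ (by fun_prop)]
        simp only [hvec]
    _ = ∫⁻ z, ENNReal.ofReal (ratioDensity (w / v) c z) * G z := by
        rw [lintegral_channel hv hw c (h := fun p => G (p.2 / p.1)) (by fun_prop),
          lintegral_ratio (NNReal.coe_pos.2 hv) (NNReal.coe_pos.2 hw) c hGm]
    _ = ∫⁻ θ in Set.Ioc a (a + 2 * Real.pi),
          ENNReal.ofReal (phaseDiffDensity (w / v) c θ) * g θ :=
        lintegral_ratioDensity_mul_comp_arg hγ c a hg
    _ = _ := by
        have hd := measurable_phaseDiffDensity (w / v) c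
        rw [withDensity_indicator measurableSet_Ioc,
          lintegral_withDensity_eq_lintegral_mul _ (by fun_prop) hg]
        rfl

theorem lemma2 {S : Type*} [MeasurableSpace S] (P : Measure S) [IsProbabilityMeasure P]
    (Ω₀ Ω₁ : ℝ≥0) (hΩ₀ : 0 < Ω₀) (hΩ₁ : 0 < Ω₁) (c : ℂ)
    (X₁ : S → ℂ) (x₀ : S → Fin 2 → ℂ)
    (hX₁ : HasLaw X₁ (cscg Ω₁) P) (hx₀ : HasLaw x₀ (cscgVec 2 Ω₀) P)
    (hindep : IndepFun X₁ x₀ P)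
    (Y : S → Fin 2 → ℂ) (hY : ∀ ω, Y ω = X₁ ω • ![1, c] + x₀ ω)
    (a : ℝ) (Θ : S → ℝ)
    (hΘ_mem : ∀ᵐ ω ∂P, Θ ω ∈ Set.Icc a (a + 2 * Real.pi))
    (hΘ : ∀ᵐ ω ∂P, (Θ ω : Real.Angle) =
      (Complex.arg ((starRingEnd ℂ) (Y ω 0) * Y ω 1) : Real.Angle) -
        (Complex.arg c : Real.Angle)) :
    HasPDF Θ P volume ∧
      (fun θ => (pdf Θ P volume θ).toReal) =ᵐ[volume]
        (Set.Icc a (a + 2 * Real.pi)).indicator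
          (phaseDiffDensity ((Ω₁ : ℝ) / (Ω₀ : ℝ)) c) := by
  have hγ : (0 : ℝ) < Ω₁ / Ω₀ := div_pos (NNReal.coe_pos.2 hΩ₁) (NNReal.coe_pos.2 hΩ₀)
  have hT := hasLaw_phaseDiff hΩ₀ hΩ₁ c hX₁ hx₀ hindep a
  set T : S → ℝ := fun ω => toIocMod Real.two_pi_pos a (Complex.arg
    ((starRingEnd ℂ) (X₁ ω + x₀ ω 0) * (c * X₁ ω + x₀ ω 1)) - Complex.arg c) with hTdef
  set f : ℝ → ENNReal := (Set.Ioc a (a + 2 * Real.pi)).indicator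
    fun θ => ENNReal.ofReal (phaseDiffDensity (Ω₁ / Ω₀) c θ) with hf
  have hfm : Measurable f :=
    (measurable_phaseDiffDensity _ c).ennreal_ofReal.indicator measurableSet_Ioc
  -- `Θ` may take the value `a`, where the half-open representative `T` is `a + 2π`. That event is
  -- null because the law of `T` has a density.
  have hT_ne : ∀ᵐ ω ∂P, T ω ≠ a + 2 * Real.pi := by
    have h : ∀ᵐ t ∂(P.map T), t ≠ a + 2 * Real.pi := by
      rw [hT.map_eq]
      exact (withDensity_absolutelyContinuous _ _).ae_le (Measure.ae_ne volume _)
    exact ae_of_ae_map hT.aemeasurable h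
  have hΘT : T =ᵐ[P] Θ := by
    filter_upwards [hΘ_mem, hΘ, hT_ne] with ω hmem hang hne
    have hY0 : Y ω 0 = X₁ ω + x₀ ω 0 := by simp [hY]
    have hY1 : Y ω 1 = c * X₁ ω + x₀ ω 1 := by simp [hY, mul_comm]
    rw [hY0, hY1, ← Real.Angle.coe_sub] at hang
    have hTΘ : T ω = toIocMod Real.two_pi_pos a (Θ ω) :=
      (toIocMod_two_pi_eq_of_angle_eq a hang).symm
    rcases eq_or_lt_of_le hmem.1 with h | h
    · rw [← h, toIocMod_apply_left] at hTΘ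
      exact absurd hTΘ hne
    · rw [hTΘ]
      exact (toIocMod_eq_self _).2 ⟨h, hmem.2⟩
  have hlaw : HasLaw Θ (volume.withDensity f) P := hT.congr hΘT.symm
  have hpdf : HasPDF Θ P volume :=
    hasPDF_of_map_eq_withDensity hlaw.aemeasurable f hfm.aemeasurable hlaw.map_eq
  refine ⟨hpdf, ?_⟩
  have h := (pdf.eq_of_map_eq_withDensity f hfm.aemeasurable).1 hlaw.map_eq
  -- The indicators of `Ioc` and `Icc` can differ only at the point `a`, which is discarded.
  filter_upwards [h, Measure.ae_ne volume a] with θ hθ hne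
  rw [hθ, hf]
  by_cases hm : θ ∈ Set.Icc a (a + 2 * Real.pi)
  · have hm' : θ ∈ Set.Ioc a (a + 2 * Real.pi) := ⟨lt_of_le_of_ne hm.1 hne.symm, hm.2⟩
    rw [Set.indicator_of_mem hm, Set.indicator_of_mem hm',
      ENNReal.toReal_ofReal (phaseDiffDensity_nonneg hγ c θ)]
  · rw [Set.indicator_of_notMem hm,
      Set.indicator_of_notMem (fun h => hm (Set.Ioc_subset_Icc_self h)), ENNReal.toReal_zero]
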